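/- **Conventions.** An atom of a monoid $M$ is an element $a\neq 1$ such that $a=bc$ implies $b=1$ or $c=1$. $M$ is atomic if its atoms are finite in number and generate $M$, and each $x\in M$ has a bound on the number of factors in its expressions as a product of atoms. Write $x\le_L y$ if $y=xz$ for some $z$, and $x\le_R y$ if $y=zx$ for some $z$. $M$ is right (left) Gaussian if it is atomic, left and right cancellative, and $(M,\le_L)$ (respectively $(M,\le_R)$) is a lattice. A Garside element of $M$ is a $\Delta\in M$ whose left divisors coincide with its right divisors, are finite in number and generate $M$; a Garside monoid is a left and right Gaussian monoid that has a Garside element. In a right Gaussian monoid, $x\vee y$ is the right l.c.m. (the join for $\le_L$), and $x\backslash y$ is the unique $z$ with $x\vee y=xz$. The group of fractions of $M$ is the group with the same presentation as $M$. Quandles are right distributive, products without parentheses are left-associated, and for a subset $S$ of a group $G$ the Dehn quandle $\mathcal D(S^G)$ is the set of all conjugates of elements of $S$ in $G$ with $x*y=yxy^{-1}$. For a right Gaussian monoid $M$ with set of atoms $A$ consider the conditions: * (ii) $s\backslash t\le_L s\vee t$ for all $s,t\in A$; * (iii) $(s\backslash t)\backslash(s\vee t)\in A$ for all $s,t\in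 A$; * (iv) $M$ has a finite presentation $\langle A\mid R\rangle$ in which the two words of each relation have equal length; * (v) for all $s\in A$ and $x\in M$ there is $y\in M$ with $xy\le_L sxy$; * (vi) there are a Garside monoid $N$, a finite generating set $T$ of $N$, a Garside element $\Delta$ of $N$ with $T\Delta=\Delta T$, and a surjective homomorphism $\pi:N\to M$ with $\pi(T)=A$. $M$ is of type $\mathcal R_4$ if (ii), (iii), (v) hold; of type $\mathcal R_5$ if (ii), (iv), (v) hold; of type $\mathcal R_6$ if (ii), (iii), (vi) hold; of type $\mathcal R_7$ if (ii), (iv), (vi) hold. A Garside monoid is of type $\mathcal R_8$ if (ii), (iii) hold, and of type $\mathcal R_9$ if (ii), (iv) hold. A right l.c.m. selector on $A$ in $M$ is a map $f$ from $A\times A$ to the words in $A$ such that $f(s,t)$ is empty if and only if $s=t$, and $f(s,t)$ represents $s\backslash t$ for all $s,t\in A$. **Statement.** Let $M$ be either a right Gaussian monoid of type $\mathcal R_4$, $\mathcal R_5$, $\mathcal R_6$ or $\mathcal R_7$, or a Garside monoid of type $\mathcal R_8$ or $\mathcal R_9$. Let $A$ be the set of atoms of $M$, $G$ the group of fractions of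 $M$, and $f$ a right l.c.m. selector on $A$ in $M$. For $a\ne b$ in $A$ write $f(a,b)=f_1(a,b)f_2(a,b)\cdots f_{n_{ab}}(a,b)$ with $f_i(a,b)\in A$. Then $\beta(a,b)=(a\backslash b)\backslash(a\vee b)$ defines a map $\beta:A\times A\to A$, and the quandle $\mathcal D(A^G)$ (the set $A$ being identified with its image in $G$) has a presentation with $A$ as its set of generators and the defining relations $$\beta(a,b)*f_{n_{ab}}(a,b)*f_{n_{ab}-1}(a,b)*\cdots*f_1(a,b)=a,$$ $$c*f_{n_{ab}}(a,b)*\cdots*f_1(a,b)*a=c*f_{n_{ba}}(b,a)*\cdots*f_1(b,a)*b$$ for all $a,b,c\in A$ with $a\neq b$. -/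

import Mathlib

universe u v

/-! ### Monoids: atoms, divisibility, Gaussian and Garside monoids -/

/-- An atom of a monoid: an element `a ≠ 1` such that `a = b * c` implies `b = 1` or `c = 1`. -/
def IsMonoidAtom {M : Type u} [Monoid M] (a : M) : Prop :=
  a ≠ 1 ∧ ∀ b c : M, a = b * c → b = 1 ∨ c = 1

/-- The set of atoms of a monoid. -/
def monoidAtoms (M : Type u) [Monoid M] : Set M := {a | IsMonoidAtom a}

/-- `M` is atomic: its atoms are finite in number and generate `M`, and for each `x` there is a
bound on the number of factors in the expressions of `x` as a product of atoms. -/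
def IsAtomicMonoid (M : Type u) [Monoid M] : Prop :=
  (monoidAtoms M).Finite ∧ Submonoid.closure (monoidAtoms M) = ⊤ ∧
    ∀ x : M, ∃ n : ℕ, ∀ l : List M, (∀ a ∈ l, a ∈ monoidAtoms M) → l.prod = x → l.length ≤ n

/-- `x` is a left divisor of `y` (`x ≤_L y`). -/
def LeftDiv {M : Type u} [Monoid M] (x y : M) : Prop := ∃ z, y = x * z

/-- `x` is a right divisor of `y` (`x ≤_R y`). -/
def RightDiv {M : Type u} [Monoid M] (x y : M) : Prop := ∃ z, y = z * x

/-- `z` is a greatest lower bound of `x` and `y` for the relation `r`. For `r = LeftDiv` this says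
that `z` is a left g.c.d. of `x` and `y`. -/
def IsMeetFor {M : Type u} (r : M → M → Prop) (x y z : M) : Prop :=
  r z x ∧ r z y ∧ ∀ w, r w x → r w y → r w z

/-- `z` is a least upper bound of `x` and `y` for the relation `r`. For `r = LeftDiv` this says
that `z` is a right l.c.m. of `x` and `y`. -/
def IsJoinFor {M : Type u} (r : M → M → Prop) (x y z : M) : Prop :=
  r x z ∧ r y z ∧ ∀ w, r x w → r y w → r z w

/-- `(M, r)` is a lattice. -/
def IsLatticeRel {M : Type u} (r : M → M → Prop) : Prop :=
  IsPartialOrder M r ∧ (∀ x y, ∃ z, IsMeetFor r x y z) ∧ ∀ x y, ∃ z, IsJoinFor r x y z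

/-- Right Gaussian monoids: atomic, left and right cancellative, and a lattice for left
divisibility. -/
class IsRightGaussian (M : Type u) [Monoid M] : Prop where
  atomic : IsAtomicMonoid M
  mul_left_cancel : ∀ x y z : M, x * y = x * z → y = z
  mul_right_cancel : ∀ x y z : M, y * x = z * x → y = z
  left_lattice : IsLatticeRel (LeftDiv (M := M))

/-- Left Gaussian monoids: atomic, left and right cancellative, and a lattice for right
divisibility. -/
class IsLeftGaussian (M : Type u) [Monoid M] : Prop where
  atomic : IsAtomicMonoid M
  mul_left_cancel : ∀ x y z : M, x * y = x * z → y = z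
  mul_right_cancel : ∀ x y z : M, y * x = z * x → y = z
  right_lattice : IsLatticeRel (RightDiv (M := M))

/-- A Garside element of a monoid: its left divisors coincide with its right divisors, they are
finite in number and they generate the monoid. -/
def IsGarsideElement {M : Type u} [Monoid M] (Δ : M) : Prop :=
  {x : M | LeftDiv x Δ} = {x : M | RightDiv x Δ} ∧ {x : M | LeftDiv x Δ}.Finite ∧
    Submonoid.closure {x : M | LeftDiv x Δ} = ⊤

/-- Garside monoids: right and left Gaussian monoids that contain a Garside element. -/
class IsGarside (M : Type u) [Monoid M] : Prop extends IsRightGaussian M, IsLeftGaussian M where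
  exists_garside : ∃ Δ : M, IsGarsideElement Δ

section Residues

variable {M : Type u} [Monoid M] [IsRightGaussian M]

/-- The right l.c.m. `x ∨ y` of two elements of a right Gaussian monoid. -/
noncomputable def rightLcm (x y : M) : M :=
  Classical.choose ((IsRightGaussian.left_lattice (M := M)).2.2 x y)

theorem rightLcm_spec (x y : M) : IsJoinFor LeftDiv x y (rightLcm x y) :=
  Classical.choose_spec ((IsRightGaussian.left_lattice (M := M)).2.2 x y)

theorem rightLcm_unique {x y z : M} (h : IsJoinFor LeftDiv x y z) : z = rightLcm x y :=
  (IsRightGaussian.left_lattice (M := M)).1.antisymm _ _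
    (h.2.2 _ (rightLcm_spec x y).1 (rightLcm_spec x y).2.1)
    ((rightLcm_spec x y).2.2 _ h.1 h.2.1)

/-- The right residue `x \ y`: the unique `z` with `x ∨ y = x * z`. -/
noncomputable def rightResidue (x y : M) : M := Classical.choose (rightLcm_spec x y).1

theorem rightResidue_spec (x y : M) : rightLcm x y = x * rightResidue x y :=
  Classical.choose_spec (rightLcm_spec x y).1

theorem rightResidue_unique {x y z : M} (h : rightLcm x y = x * z) : z = rightResidue x y :=
  IsRightGaussian.mul_left_cancel x _ _ (h.symm.trans (rightResidue_spec x y))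

end Residues

/-! ### Words, presentations of monoids, groups of fractions -/

/-- The element of `M` represented by a word in the letters `S ⊆ M`. -/
def evalWord {M : Type u} [Monoid M] (S : Set M) : FreeMonoid S →* M :=
  FreeMonoid.lift (Subtype.val : S → M)

/-- `M` has a finite homogeneous presentation `⟨S ∣ R⟩` on the subset `S` of `M`: the set `S` is
finite and generates `M`, and the congruence on words of representing the same element of `M` is
generated by a finite set `R` of pairs of words of equal length. -/
def HasFiniteHomogeneousPresentation {M : Type u} [Monoid M] (S : Set M) : Prop :=
  S.Finite ∧ Submonoid.closure S = ⊤ ∧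
    ∃ R : Set (FreeMonoid S × FreeMonoid S), R.Finite ∧
      (∀ p ∈ R, p.1.length = p.2.length) ∧
      Con.ker (evalWord S) = conGen (fun x y => (x, y) ∈ R)

/-- The relations `of a * of b = of (a * b)` of the multiplication table of `M`. -/
def multiplicationTable (M : Type u) [Monoid M] : Set (FreeGroup M) :=
  {r | ∃ a b : M, r = FreeGroup.of a * FreeGroup.of b * (FreeGroup.of (a * b))⁻¹}

/-- The group of fractions of `M`: the group that has the same presentation as the monoid `M`.
The presentation used here is the multiplication table of `M`; by the universal property
`GroupOfFractions.exists_unique_lift` all presentations of `M` give the same group. -/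
abbrev GroupOfFractions (M : Type u) [Monoid M] : Type u := PresentedGroup (multiplicationTable M)

theorem GroupOfFractions.of_mul {M : Type u} [Monoid M] (a b : M) :
    (PresentedGroup.of (a * b) : GroupOfFractions M) =
      PresentedGroup.of a * PresentedGroup.of b := by
  have h : PresentedGroup.mk (multiplicationTable M)
      (FreeGroup.of a * FreeGroup.of b * (FreeGroup.of (a * b))⁻¹) = 1 :=
    PresentedGroup.one_of_mem ⟨a, b, rfl⟩
  rw [map_mul, map_mul, map_inv, mul_inv_eq_one] at h
  exact h.symm

/-- The canonical homomorphism from `M` to its group of fractions. -/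
def toGroupOfFractions (M : Type u) [Monoid M] : M →* GroupOfFractions M :=
  MonoidHom.mk' (G := GroupOfFractions M) PresentedGroup.of GroupOfFractions.of_mul

theorem GroupOfFractions.exists_unique_lift {M : Type u} [Monoid M] {G : Type v} [Group G]
    (g : M →* G) :
    ∃! h : GroupOfFractions M →* G, h.comp (toGroupOfFractions M) = g := by
  have hr : ∀ r ∈ multiplicationTable M, FreeGroup.lift (g : M → G) r = 1 := by
    rintro r ⟨a, b, rfl⟩
    simp
  refine ⟨PresentedGroup.toGroup hr, ?_, ?_⟩
  · ext a
    exact PresentedGroup.toGroup.of hr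
  · intro h hh
    apply PresentedGroup.ext
    intro a
    rw [PresentedGroup.toGroup.of hr]
    exact DFunLike.congr_fun hh a

/-! ### Conditions on a generating set, types of monoids -/

/-- `s \ t ≤_L s ∨ t` for all `s, t ∈ S`. -/
def ResidueDividesLcm {M : Type u} [Monoid M] [IsRightGaussian M] (S : Set M) : Prop :=
  ∀ s ∈ S, ∀ t ∈ S, LeftDiv (rightResidue s t) (rightLcm s t)

/-- `(s \ t) \ (s ∨ t) ∈ S` for all `s, t ∈ S`. -/
def ResidueClosed {M : Type u} [Monoid M] [IsRightGaussian M] (S : Set M) : Prop :=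
  ∀ s ∈ S, ∀ t ∈ S, rightResidue (rightResidue s t) (rightLcm s t) ∈ S

/-- For all `s ∈ S` and `x` there is `y` with `x * y ≤_L s * x * y`. -/
def HasConjugatingMultiples {M : Type u} [Monoid M] (S : Set M) : Prop :=
  ∀ s ∈ S, ∀ x : M, ∃ y : M, LeftDiv (x * y) (s * x * y)

/-- There are a Garside monoid `N`, a finite generating set `T` of `N`, a Garside element `Δ` of
`N` with `TΔ = ΔT`, and an epimorphism from `N` onto `M` that maps `T` onto `S`. -/
def HasGarsideCover {M : Type u} [Monoid M] (S : Set M) : Prop :=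
  ∃ (N : Type v) (_ : Monoid N) (_ : IsGarside N) (T : Set N) (Δ : N) (π : N →* M),
    T.Finite ∧ Submonoid.closure T = ⊤ ∧ IsGarsideElement Δ ∧
      (fun t => t * Δ) '' T = (fun t => Δ * t) '' T ∧ Function.Surjective π ∧ π '' T = S

section Types

variable (M : Type u) [Monoid M] [IsRightGaussian M]

/-- Right Gaussian monoids of type `R₄`. -/
def IsTypeR4 : Prop :=
  ResidueDividesLcm (monoidAtoms M) ∧ ResidueClosed (monoidAtoms M) ∧
    HasConjugatingMultiples (monoidAtoms M)

/-- Right Gaussian monoids of type `R₅`. -/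
def IsTypeR5 : Prop :=
  ResidueDividesLcm (monoidAtoms M) ∧ HasFiniteHomogeneousPresentation (monoidAtoms M) ∧
    HasConjugatingMultiples (monoidAtoms M)

/-- Right Gaussian monoids of type `R₆`. -/
def IsTypeR6 : Prop :=
  ResidueDividesLcm (monoidAtoms M) ∧ ResidueClosed (monoidAtoms M) ∧
    HasGarsideCover.{u, v} (monoidAtoms M)

/-- Right Gaussian monoids of type `R₇`. -/
def IsTypeR7 : Prop :=
  ResidueDividesLcm (monoidAtoms M) ∧ HasFiniteHomogeneousPresentation (monoidAtoms M) ∧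
    HasGarsideCover.{u, v} (monoidAtoms M)

end Types

/-- Garside monoids of type `R₈`. -/
def IsTypeR8 (N : Type u) [Monoid N] [IsGarside N] : Prop :=
  ResidueDividesLcm (monoidAtoms N) ∧ ResidueClosed (monoidAtoms N)

/-- Garside monoids of type `R₉`. -/
def IsTypeR9 (N : Type u) [Monoid N] [IsGarside N] : Prop :=
  ResidueDividesLcm (monoidAtoms N) ∧ HasFiniteHomogeneousPresentation (monoidAtoms N)

/-- A right l.c.m. selector on `S` in `M`: a map `f : S × S → S*` such that `f s t` is the empty
word if and only if `s = t`, and such that `f s t` represents `s \ t`. -/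
def IsRightLcmSelector {M : Type u} [Monoid M] [IsRightGaussian M] (S : Set M)
    (f : S → S → FreeMonoid S) : Prop :=
  (∀ s t, f s t = 1 ↔ s = t) ∧ ∀ s t : S, evalWord S (f s t) = rightResidue (s : M) (t : M)

/-! ### Quandles

Mathlib writes quandles with a left action. A right distributive quandle `(X, *)` is a Mathlib
quandle through `x * y = Shelf.act y x`. -/

/-- The product `x * y` of a right distributive quandle. -/
def quandleStar {Q : Type u} [Quandle Q] (x y : Q) : Q := Shelf.act y x

/-- The Dehn quandle `D(S^G)`: the set of all conjugates of elements of `S` in `G`, with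
`x * y = y x y⁻¹`. -/
def DehnQuandle {G : Type u} [Group G] (S : Set G) : Type u := ↥(Group.conjugatesOfSet S)

namespace DehnQuandle

variable {G : Type u} [Group G] {S : Set G}

/-- An element of `S` as an element of the Dehn quandle. -/
def of (s : G) (hs : s ∈ S) : DehnQuandle S := ⟨s, Group.subset_conjugatesOfSet hs⟩

instance : Quandle (DehnQuandle S) where
  act y x := ⟨y.1 * x.1 * y.1⁻¹, Group.conj_mem_conjugatesOfSet x.2⟩
  self_distrib := by
    intro x y z
    apply Subtype.ext
    simp [mul_assoc]
  invAct y x := ⟨y.1⁻¹ * x.1 * y.1, by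
    have h := Group.conj_mem_conjugatesOfSet (c := y.1⁻¹) x.2
    rwa [inv_inv] at h⟩
  left_inv := by
    intro y x
    apply Subtype.ext
    simp [mul_assoc]
  right_inv := by
    intro y x
    apply Subtype.ext
    simp [mul_assoc]
  fix := by
    intro x
    apply Subtype.ext
    simp

theorem star_val (x y : DehnQuandle S) : (quandleStar x y).1 = y.1 * x.1 * y.1⁻¹ := rfl

end DehnQuandle

/-- Formal quandle expressions in the letters `X`: `star x y` stands for `x * y` and `invStar x y`
for `x *⁻¹ y`. -/
inductive QuandleTerm (X : Type u) : Type u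
  | of : X → QuandleTerm X
  | star : QuandleTerm X → QuandleTerm X → QuandleTerm X
  | invStar : QuandleTerm X → QuandleTerm X → QuandleTerm X

/-- The value of an expression in a quandle, for given values of the letters. -/
def QuandleTerm.eval {X : Type u} {Q : Type v} [Quandle Q] (g : X → Q) : QuandleTerm X → Q
  | .of x => g x
  | .star x y => quandleStar (x.eval g) (y.eval g)
  | .invStar x y => Rack.invAct (y.eval g) (x.eval g)

/-- The smallest equivalence relation on expressions that is compatible with both operations, and
contains the given relations and the axioms of a (right distributive) quandle. -/
inductive QuandleTerm.Equiv {X : Type u} (rels : QuandleTerm X → QuandleTerm X → Prop) :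
    QuandleTerm X → QuandleTerm X → Prop
  | rel {x y : QuandleTerm X} : rels x y → QuandleTerm.Equiv rels x y
  | refl (x : QuandleTerm X) : QuandleTerm.Equiv rels x x
  | symm {x y : QuandleTerm X} : QuandleTerm.Equiv rels x y → QuandleTerm.Equiv rels y x
  | trans {x y z : QuandleTerm X} :
      QuandleTerm.Equiv rels x y → QuandleTerm.Equiv rels y z → QuandleTerm.Equiv rels x z
  | star {x x' y y' : QuandleTerm X} : QuandleTerm.Equiv rels x x' → QuandleTerm.Equiv rels y y' →
      QuandleTerm.Equiv rels (x.star y) (x'.star y')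
  | invStar {x x' y y' : QuandleTerm X} : QuandleTerm.Equiv rels x x' → QuandleTerm.Equiv rels y y' →
      QuandleTerm.Equiv rels (x.invStar y) (x'.invStar y')
  | idem (x : QuandleTerm X) : QuandleTerm.Equiv rels (x.star x) x
  | star_invStar (x y : QuandleTerm X) : QuandleTerm.Equiv rels ((x.star y).invStar y) x
  | invStar_star (x y : QuandleTerm X) : QuandleTerm.Equiv rels ((x.invStar y).star y) x
  | distrib (x y z : QuandleTerm X) :
      QuandleTerm.Equiv rels ((x.star y).star z) ((x.star z).star (y.star z))

/-- The setoid of `QuandleTerm.Equiv`. -/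
def QuandleTerm.equivSetoid {X : Type u} (rels : QuandleTerm X → QuandleTerm X → Prop) :
    Setoid (QuandleTerm X) where
  r := QuandleTerm.Equiv rels
  iseqv := ⟨.refl, .symm, .trans⟩

/-- The quandle with the presentation `⟨X ∣ rels⟩`. -/
def PresentedQuandle {X : Type u} (rels : QuandleTerm X → QuandleTerm X → Prop) : Type u :=
  Quotient (QuandleTerm.equivSetoid rels)

namespace PresentedQuandle

variable {X : Type u} {rels : QuandleTerm X → QuandleTerm X → Prop}

/-- The class of an expression. -/
def mk (rels : QuandleTerm X → QuandleTerm X → Prop) (t : QuandleTerm X) : PresentedQuandle rels :=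
  Quotient.mk (QuandleTerm.equivSetoid rels) t

/-- The generators. -/
def of (rels : QuandleTerm X → QuandleTerm X → Prop) (x : X) : PresentedQuandle rels :=
  mk rels (.of x)

instance : Quandle (PresentedQuandle rels) where
  act y x := Quotient.liftOn₂ x y (fun s t => mk rels (s.star t))
    (fun _ _ _ _ h₁ h₂ => Quotient.sound (QuandleTerm.Equiv.star h₁ h₂))
  self_distrib := by
    rintro ⟨x⟩ ⟨y⟩ ⟨z⟩
    exact Quotient.sound (QuandleTerm.Equiv.distrib z y x)
  invAct y x := Quotient.liftOn₂ x y (fun s t => mk rels (s.invStar t))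
    (fun _ _ _ _ h₁ h₂ => Quotient.sound (QuandleTerm.Equiv.invStar h₁ h₂))
  left_inv := by
    rintro ⟨y⟩ ⟨x⟩
    exact Quotient.sound (QuandleTerm.Equiv.star_invStar x y)
  right_inv := by
    rintro ⟨y⟩ ⟨x⟩
    exact Quotient.sound (QuandleTerm.Equiv.invStar_star x y)
  fix := by
    rintro ⟨x⟩
    exact Quotient.sound (QuandleTerm.Equiv.idem x)

theorem star_mk (s t : QuandleTerm X) :
    quandleStar (mk rels s) (mk rels t) = mk rels (s.star t) := rfl

/-- The universal property: a map of the generators to a quandle that respects the relations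
extends to a unique homomorphism. -/
theorem exists_unique_lift {Q : Type v} [Quandle Q] (g : X → Q)
    (hg : ∀ s t, rels s t → s.eval g = t.eval g) :
    ∃! h : PresentedQuandle rels → Q,
      (∀ x y, h (quandleStar x y) = quandleStar (h x) (h y)) ∧ ∀ x, h (of rels x) = g x := by
  have key : ∀ s t, QuandleTerm.Equiv rels s t → s.eval g = t.eval g := by
    intro s t h
    induction h with
    | rel h => exact hg _ _ h
    | refl => rfl
    | symm _ ih => exact ih.symm
    | trans _ _ ih₁ ih₂ => exact ih₁.trans ih₂
    | star _ _ ih₁ ih₂ => simp only [QuandleTerm.eval, ih₁, ih₂]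
    | invStar _ _ ih₁ ih₂ => simp only [QuandleTerm.eval, ih₁, ih₂]
    | idem => exact Quandle.fix
    | star_invStar => exact Rack.left_inv _ _
    | invStar_star => exact Rack.right_inv _ _
    | distrib => exact Shelf.self_distrib
  refine ⟨Quotient.lift (QuandleTerm.eval g) key, ⟨?_, fun _ => rfl⟩, ?_⟩
  · rintro ⟨x⟩ ⟨y⟩
    rfl
  · rintro h ⟨h₁, h₂⟩
    funext x
    obtain ⟨t, rfl⟩ : ∃ t, mk rels t = x := Quotient.exists_rep x
    change h (mk rels t) = t.eval g
    induction t with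
    | of x => exact h₂ x
    | star s t ihs iht =>
      rw [← star_mk, h₁, ihs, iht]
      rfl
    | invStar s t ihs iht =>
      rw [QuandleTerm.eval, ← ihs, ← iht, ← Rack.left_cancel (h (mk rels t)), Rack.right_inv]
      refine (h₁ (mk rels (s.invStar t)) (mk rels t)).symm.trans (congrArg h ?_)
      exact Quotient.sound (QuandleTerm.Equiv.invStar_star s t)

end PresentedQuandle

/-- The quandle `Q` has the presentation `⟨X ∣ rels⟩`, the letter `x` standing for `ι x`. -/
def HasQuandlePresentation {X : Type u} (Q : Type v) [Quandle Q] (ι : X → Q)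
    (rels : QuandleTerm X → QuandleTerm X → Prop) : Prop :=
  ∃ e : PresentedQuandle rels ≃ Q,
    (∀ x y, e (quandleStar x y) = quandleStar (e x) (e y)) ∧
      ∀ x, e (PresentedQuandle.of rels x) = ι x

/-- For a word `w = w₁ w₂ ⋯ wₙ`, the left-associated product `c * wₙ * wₙ₋₁ * ⋯ * w₁`. -/
def starWord {X : Type u} (c : QuandleTerm X) (w : FreeMonoid X) : QuandleTerm X :=
  w.toList.foldr (fun x t => t.star (.of x)) c

/-- The relations `β(a,b) * fₙ(a,b) * ⋯ * f₁(a,b) = a` and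
`c * fₙ(a,b) * ⋯ * f₁(a,b) * a = c * fₘ(b,a) * ⋯ * f₁(b,a) * b` for `a, b, c ∈ X` with `a ≠ b`,
where `f(a,b)` is the word `f₁(a,b) ⋯ fₙ(a,b)`, and `f(b,a)` the word `f₁(b,a) ⋯ fₘ(b,a)`. -/
inductive SelectorRelation {X : Type u} (β : X → X → X) (f : X → X → FreeMonoid X) :
    QuandleTerm X → QuandleTerm X → Prop
  | first (a b : X) : a ≠ b → SelectorRelation β f (starWord (.of (β a b)) (f a b)) (.of a)
  | second (a b c : X) : a ≠ b → SelectorRelation β f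
      ((starWord (.of c) (f a b)).star (.of a)) ((starWord (.of c) (f b a)).star (.of b))

/-- `D(A^G)` for the set `A` of atoms of `M` and the group of fractions `G` of `M`. -/
abbrev AtomQuandle (M : Type u) [Monoid M] : Type u :=
  DehnQuandle (toGroupOfFractions M '' monoidAtoms M)

/-- The atom `a` as an element of `D(A^G)`. -/
def atomToQuandle (M : Type u) [Monoid M] (a : monoidAtoms M) : AtomQuandle M :=
  DehnQuandle.of (toGroupOfFractions M a) ⟨a, a.2, rfl⟩

/-! ### Words in the atoms -/

section Words

variable {M : Type u} [Monoid M]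

/-! Write `Q` for the presented quandle and `[a]` for its generators. The selector relations hold in
the Dehn quandle, which gives a homomorphism `e` from `Q` (`atomToQuandle_respects`). The second
relations say that the words `a f(a,b)` and `b f(b,a)` act alike on `Q`. The monoid is presented by
exactly these pairs of words (`map_eq_of_evalWord_eq`), so the group of fractions acts on `Q` by
automorphisms, and `e` carries this action to conjugation. Every element of `Q` lies in the orbit of
a generator, so surjectivity is clear.

Injectivity reduces to `action_of_eq_of_conj`: if `g` conjugates `a` to `b`, then `g` sends `[a]` to
`[b]`. Write `g = x y⁻¹`. By `HasConjugatingMultiples`, after extending `x` and `y` by a common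
factor, `a y = y z` in the monoid; then `b x = x z`, as the monoid embeds in its group. By
`exists_atom_of_mul_eq_mul`, which peels residues off `y` by means of the first relations, `z` is an
atom with `y [z] = [a]`; likewise `x [z] = [b]`.

The types differ only in how the hypotheses arise: a homogeneous presentation yields `ResidueClosed`
by counting letters, and a Garside element, in the monoid or in a cover, yields
`HasConjugatingMultiples` through its powers. -/

@[simp]
theorem evalWord_of (S : Set M) (a : S) : evalWord S (FreeMonoid.of a) = a :=
  FreeMonoid.lift_eval_of _ _

theorem evalWord_eq_prod (S : Set M) (w : FreeMonoid S) :
    evalWord S w = (w.toList.map Subtype.val).prod := by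
  rw [evalWord, FreeMonoid.lift_apply]

theorem evalWord_surjective {S : Set M} (h : Submonoid.closure S = ⊤) :
    Function.Surjective (evalWord S) := by
  rw [← MonoidHom.mrange_eq_top, evalWord, FreeMonoid.mrange_lift, Subtype.range_coe, h]

theorem IsAtomicMonoid.exists_length_le (h : IsAtomicMonoid M) (x : M) :
    ∃ n : ℕ, ∀ w : FreeMonoid (monoidAtoms M), evalWord _ w = x → w.length ≤ n := by
  obtain ⟨n, hn⟩ := h.2.2 x
  refine ⟨n, fun w hw => ?_⟩
  have := hn (w.toList.map Subtype.val) (by simp +contextual) (by rw [← evalWord_eq_prod, hw])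
  simpa [FreeMonoid.length] using this

/-- All powers of `w` represent `1` as well, so a nonempty `w` would contradict the length bound for
`1`. -/
theorem IsAtomicMonoid.eq_one_of_evalWord_eq_one (h : IsAtomicMonoid M)
    (w : FreeMonoid (monoidAtoms M)) (hw : evalWord _ w = 1) : w = 1 := by
  obtain ⟨n, hn⟩ := h.exists_length_le 1
  have h1 := hn (w ^ (n + 1)) (by rw [map_pow, hw, one_pow])
  have h2 : ∀ k : ℕ, (w ^ k).length = k * w.length := by
    intro k
    induction k with
    | zero => simp
    | succ k ih => rw [pow_succ, FreeMonoid.length_mul, ih]; ring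
  rw [h2] at h1
  refine FreeMonoid.length_eq_zero.1 ?_
  by_contra h0
  nlinarith [Nat.pos_of_ne_zero h0]

theorem exists_length_eq_of_homogeneous {S : Set M} (h : HasFiniteHomogeneousPresentation S)
    {w w' : FreeMonoid S} (hw : evalWord S w = evalWord S w') : w.length = w'.length := by
  obtain ⟨-, -, R, -, hR, hker⟩ := h
  let len : FreeMonoid S →* Multiplicative ℕ :=
    { toFun := fun w => Multiplicative.ofAdd w.length
      map_one' := rfl
      map_mul' := fun x y => by rw [FreeMonoid.length_mul, ofAdd_add] }
  have h1 : Con.ker (evalWord S) ≤ Con.ker len := by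
    rw [hker, Con.conGen_le]
    intro x y hxy
    exact congrArg Multiplicative.ofAdd (hR _ hxy)
  exact Multiplicative.ofAdd.injective (h1 (x := w) (y := w') hw)

end Words

/-! ### Right least common multiples -/

section RightGaussian

variable {M : Type u} [Monoid M] [IsRightGaussian M]

theorem mul_rightResidue_comm (x y : M) : x * rightResidue x y = y * rightResidue y x := by
  rw [← rightResidue_spec, ← rightResidue_spec]
  exact rightLcm_unique ⟨(rightLcm_spec x y).2.1, (rightLcm_spec x y).1,
    fun w h1 h2 => (rightLcm_spec x y).2.2 w h2 h1⟩

theorem mul_rightResidue_of_leftDiv {x y : M} (h : LeftDiv x y) : x * rightResidue x y = y := by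
  rw [← rightResidue_spec]
  exact (rightLcm_unique ⟨h, ⟨1, (mul_one y).symm⟩, fun w _ h2 => h2⟩).symm

/-- A common right multiple of `x` and `y` is a right multiple of their right l.c.m. -/
theorem exists_eq_rightResidue_mul {x y u v : M} (h : x * u = y * v) :
    ∃ z, u = rightResidue x y * z ∧ v = rightResidue y x * z := by
  obtain ⟨z, hz⟩ := (rightLcm_spec x y).2.2 (x * u) ⟨u, rfl⟩ ⟨v, h⟩
  rw [rightResidue_spec] at hz
  refine ⟨z, ?_, ?_⟩
  · apply IsRightGaussian.mul_left_cancel x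
    rw [hz, mul_assoc]
  · apply IsRightGaussian.mul_left_cancel y
    rw [← h, hz, mul_rightResidue_comm, mul_assoc]

/-- A right Gaussian monoid is presented by its atoms and the relations
`a * (a \ b) = b * (b \ a)`. -/
theorem map_eq_of_evalWord_eq {P : Type v} [Monoid P]
    {f : monoidAtoms M → monoidAtoms M → FreeMonoid (monoidAtoms M)}
    (hf : IsRightLcmSelector (monoidAtoms M) f) (φ : FreeMonoid (monoidAtoms M) →* P)
    (hφ : ∀ a b, a ≠ b → φ (FreeMonoid.of a * f a b) = φ (FreeMonoid.of b * f b a))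
    {w w' : FreeMonoid (monoidAtoms M)} (hw : evalWord _ w = evalWord _ w') : φ w = φ w' := by
  have hM : IsAtomicMonoid M := IsRightGaussian.atomic
  obtain ⟨n, hn⟩ := hM.exists_length_le (evalWord _ w)
  induction n generalizing w w' with
  | zero =>
    rw [FreeMonoid.length_eq_zero.1 (Nat.le_zero.1 (hn w rfl)),
      FreeMonoid.length_eq_zero.1 (Nat.le_zero.1 (hn w' hw.symm))]
  | succ n ih =>
    -- Removing a first letter lowers the length bound by one, so the induction hypothesis applies
    -- to tails.
    have hcancel : ∀ (c : monoidAtoms M) (u u' : FreeMonoid (monoidAtoms M)),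
        evalWord _ (FreeMonoid.of c * u) = evalWord _ w → evalWord _ u = evalWord _ u' →
          φ u = φ u' := by
      intro c u u' hu huu
      refine ih huu fun v hv => ?_
      have := hn (FreeMonoid.of c * v) (by rw [map_mul, hv, ← map_mul, hu])
      rw [FreeMonoid.length_mul, FreeMonoid.length_of] at this
      omega
    cases w using FreeMonoid.casesOn with
    | one => rw [hM.eq_one_of_evalWord_eq_one w' (by rw [← hw, map_one])]
    | of_mul a u =>
    cases w' using FreeMonoid.casesOn with
    | one => rw [hM.eq_one_of_evalWord_eq_one (FreeMonoid.of a * u) (by rw [hw, map_one])]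
    | of_mul b u' =>
    have hab : (a : M) * evalWord _ u = b * evalWord _ u' := by simpa using hw
    by_cases h : a = b
    · subst h
      rw [map_mul, map_mul, hcancel a u u' rfl (IsRightGaussian.mul_left_cancel _ _ _ hab)]
    -- Both words are compared with words through the l.c.m.: with `v` representing `z`, the chain
    -- is `a u`, `a f(a,b) v`, `b f(b,a) v`, `b u'`.
    · obtain ⟨z, hz1, hz2⟩ := exists_eq_rightResidue_mul hab
      obtain ⟨v, rfl⟩ := evalWord_surjective hM.2.1 z
      rw [← hf.2, ← map_mul] at hz1 hz2
      rw [map_mul, map_mul, hcancel a _ _ rfl hz1, hcancel b _ _ hw.symm hz2, ← map_mul,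
        ← map_mul, ← mul_assoc, ← mul_assoc, map_mul, map_mul φ (FreeMonoid.of b * f b a), hφ a b h]

theorem exists_lift_of_rightLcmSelector {P : Type v} [Monoid P]
    {f : monoidAtoms M → monoidAtoms M → FreeMonoid (monoidAtoms M)}
    (hf : IsRightLcmSelector (monoidAtoms M) f) (φ : FreeMonoid (monoidAtoms M) →* P)
    (hφ : ∀ a b, a ≠ b → φ (FreeMonoid.of a * f a b) = φ (FreeMonoid.of b * f b a)) :
    ∃ ψ : M →* P, ∀ w, ψ (evalWord _ w) = φ w := by
  have hs := evalWord_surjective (IsRightGaussian.atomic (M := M)).2.1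
  have key : ∀ w, φ (Function.surjInv hs (evalWord _ w)) = φ w := fun w =>
    map_eq_of_evalWord_eq hf φ hφ (Function.surjInv_eq hs _)
  refine ⟨⟨⟨fun x => φ (Function.surjInv hs x), ?_⟩, fun x y => ?_⟩, key⟩
  · rw [← map_one (evalWord (monoidAtoms M)), key, map_one]
  · obtain ⟨w, rfl⟩ := hs x
    obtain ⟨w', rfl⟩ := hs y
    simp only [← map_mul, key]

/-! ### The group of right fractions -/

/-- The opposite of a right Gaussian monoid satisfies the left Ore condition. -/
noncomputable abbrev oreSetOpposite : OreLocalization.OreSet (⊤ : Submonoid Mᵐᵒᵖ) where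
  ore_right_cancel x y s h :=
    ⟨1, by
      rw [MulOpposite.unop_injective
        (IsRightGaussian.mul_left_cancel _ _ _ (congrArg MulOpposite.unop h))]⟩
  oreNum x y := MulOpposite.op (rightResidue y.1.unop x.unop)
  oreDenom x y := ⟨MulOpposite.op (rightResidue x.unop y.1.unop), trivial⟩
  ore_eq x y := MulOpposite.unop_injective (mul_rightResidue_comm _ _)

/-- Cancellation and common right multiples embed the monoid in an Ore localization, taken on the
opposite side. All images there are units, so this embedding factors through the group of fractions.
-/
theorem toGroupOfFractions_injective : Function.Injective (toGroupOfFractions M) := by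
  let _ : OreLocalization.OreSet (⊤ : Submonoid Mᵐᵒᵖ) := oreSetOpposite
  let K := OreLocalization (⊤ : Submonoid Mᵐᵒᵖ) Mᵐᵒᵖ
  let g : M →* Kᵐᵒᵖ :=
    { toFun := fun m => MulOpposite.op (OreLocalization.numeratorHom (MulOpposite.op m))
      map_one' := by rw [MulOpposite.op_one, map_one, MulOpposite.op_one]
      map_mul' := fun x y => by rw [MulOpposite.op_mul, map_mul, MulOpposite.op_mul] }
  have hg : ∀ m, IsUnit (g m) := fun m =>
    (OreLocalization.numerator_isUnit (⟨MulOpposite.op m, trivial⟩ : (⊤ : Submonoid Mᵐᵒᵖ))).op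
  have hinj : Function.Injective g := by
    intro x y h
    have h1 := MulOpposite.op_injective h
    rw [OreLocalization.numeratorHom_apply, OreLocalization.numeratorHom_apply,
      OreLocalization.oreDiv_eq_iff] at h1
    obtain ⟨s, t, h2, h3⟩ := h1
    simp only [OneMemClass.coe_one, mul_one] at h3
    subst h3
    exact (IsRightGaussian.mul_right_cancel _ _ _ (congrArg MulOpposite.unop h2)).symm
  obtain ⟨k, hk, -⟩ := GroupOfFractions.exists_unique_lift (IsUnit.liftRight g hg)
  intro x y hxy
  apply hinj
  rw [← IsUnit.coe_liftRight g hg, ← IsUnit.coe_liftRight g hg, ← hk, MonoidHom.comp_apply,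
    MonoidHom.comp_apply, hxy]

theorem GroupOfFractions.closure_range (M : Type u) [Monoid M] :
    Subgroup.closure (Set.range (toGroupOfFractions M)) = ⊤ :=
  PresentedGroup.closure_range_of _

theorem GroupOfFractions.closure_atoms :
    Subgroup.closure (toGroupOfFractions M '' monoidAtoms M) = ⊤ := by
  rw [eq_top_iff, ← GroupOfFractions.closure_range, Subgroup.closure_le]
  have h : Submonoid.closure (monoidAtoms M) ≤ (Subgroup.closure
      (toGroupOfFractions M '' monoidAtoms M)).toSubmonoid.comap (toGroupOfFractions M) :=
    Submonoid.closure_le.2 fun a ha => Subgroup.subset_closure ⟨a, ha, rfl⟩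
  rw [(IsRightGaussian.atomic (M := M)).2.1] at h
  rintro _ ⟨x, rfl⟩
  exact h (Submonoid.mem_top x)

/-- Every element of the group of fractions of a right Gaussian monoid is a right fraction. -/
theorem GroupOfFractions.exists_eq_mul_inv (g : GroupOfFractions M) :
    ∃ x y : M, g = toGroupOfFractions M x * (toGroupOfFractions M y)⁻¹ := by
  have hg : g ∈ Subgroup.closure (Set.range (toGroupOfFractions M)) := by
    rw [GroupOfFractions.closure_range]; trivial
  induction hg using Subgroup.closure_induction with
  | mem _ h =>
    obtain ⟨x, rfl⟩ := h
    exact ⟨x, 1, by simp⟩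
  | one => exact ⟨1, 1, by simp⟩
  | inv _ _ ih =>
    obtain ⟨x, y, rfl⟩ := ih
    exact ⟨y, x, by simp⟩
  | mul _ _ _ _ ih ih' =>
    obtain ⟨x, y, rfl⟩ := ih
    obtain ⟨x', y', rfl⟩ := ih'
    -- The two residues turn the inner left fraction `y⁻¹ x'` into the right fraction `(y \ x') (x'
    -- \ y)⁻¹`.
    refine ⟨x * rightResidue y x', y' * rightResidue x' y, ?_⟩
    have h := congrArg (toGroupOfFractions M) (mul_rightResidue_comm y x')
    rw [map_mul, map_mul, ← eq_inv_mul_iff_mul_eq] at h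
    simp only [map_mul, h, mul_inv_rev]
    group

end RightGaussian

/-! ### Garside elements and conjugating multiples -/

section GarsideElement

variable {N : Type u} [Monoid N] {Δ : N}

theorem IsGarsideElement.exists_mul_eq_mul (h : IsGarsideElement Δ) (x : N) :
    ∃ y, x * Δ = Δ * y := by
  have hx : x ∈ Submonoid.closure {x : N | LeftDiv x Δ} := by rw [h.2.2]; trivial
  induction hx using Submonoid.closure_induction with
  | mem x hx =>
    -- With `Δ = x y`, the right divisor `y` is also a left divisor, `Δ = y z`, whence `x Δ = x y z
    -- = Δ z`.
    obtain ⟨y, hy⟩ := hx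
    have hyr : y ∈ {x : N | RightDiv x Δ} := ⟨x, hy⟩
    rw [← h.1] at hyr
    obtain ⟨z, hz⟩ := hyr
    exact ⟨z, by conv_lhs => rw [hz, ← mul_assoc, ← hy]⟩
  | one => exact ⟨1, by simp⟩
  | mul x x' _ _ ih ih' =>
    obtain ⟨y, hy⟩ := ih
    obtain ⟨y', hy'⟩ := ih'
    exact ⟨y * y', by rw [mul_assoc, hy', ← mul_assoc, hy, mul_assoc]⟩

theorem IsGarsideElement.exists_mul_pow_eq_pow_mul (h : IsGarsideElement Δ) (n : ℕ) (x : N) :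
    ∃ y, x * Δ ^ n = Δ ^ n * y := by
  induction n generalizing x with
  | zero => exact ⟨x, by simp⟩
  | succ n ih =>
    obtain ⟨y, hy⟩ := ih x
    obtain ⟨z, hz⟩ := h.exists_mul_eq_mul y
    exact ⟨z, by rw [pow_succ, ← mul_assoc, hy, mul_assoc, hz, mul_assoc]⟩

theorem IsGarsideElement.exists_leftDiv_pow (h : IsGarsideElement Δ) (x : N) :
    ∃ n : ℕ, LeftDiv x (Δ ^ n) := by
  have hx : x ∈ Submonoid.closure {x : N | LeftDiv x Δ} := by rw [h.2.2]; trivial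
  induction hx using Submonoid.closure_induction with
  | mem x hx => exact ⟨1, by rwa [pow_one]⟩
  | one => exact ⟨0, 1, by simp⟩
  | mul x x' _ _ ih ih' =>
    obtain ⟨n, y, hy⟩ := ih
    obtain ⟨n', y', hy'⟩ := ih'
    obtain ⟨z, hz⟩ := h.exists_mul_pow_eq_pow_mul n' y
    exact ⟨n + n', y' * z, by rw [pow_add, hy, mul_assoc, hz, hy']; simp only [mul_assoc]⟩

/-- Choose `y` so that `x y` is a power of `Δ`; any element can be moved across such a power. -/
theorem IsGarsideElement.exists_leftDiv_mul (h : IsGarsideElement Δ) (s x : N) :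
    ∃ y, LeftDiv (x * y) (s * x * y) := by
  obtain ⟨n, y, hy⟩ := h.exists_leftDiv_pow x
  obtain ⟨z, hz⟩ := h.exists_mul_pow_eq_pow_mul n s
  exact ⟨y, z, by rw [mul_assoc, ← hy, hz]⟩

end GarsideElement

theorem HasGarsideCover.hasConjugatingMultiples {M : Type u} [Monoid M] {S : Set M}
    (h : HasGarsideCover.{u, v} S) : HasConjugatingMultiples S := by
  obtain ⟨N, _, _, T, Δ, π, -, -, hΔ, -, hπ, -⟩ := h
  intro s _ x
  obtain ⟨s, rfl⟩ := hπ s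
  obtain ⟨x, rfl⟩ := hπ x
  obtain ⟨y, z, hz⟩ := hΔ.exists_leftDiv_mul s x
  exact ⟨π y, π z, by simp only [← map_mul, hz]⟩

theorem IsGarside.hasConjugatingMultiples {N : Type u} [Monoid N] [IsGarside N] (S : Set N) :
    HasConjugatingMultiples S := by
  obtain ⟨Δ, hΔ⟩ := IsGarside.exists_garside (M := N)
  exact fun s _ x => hΔ.exists_leftDiv_mul s x

/-! ### Residues of atoms: the commutation relation and homogeneous presentations -/

section Residues

variable {M : Type u} [Monoid M] [IsRightGaussian M]

/-- Both sides equal `a ∨ b`, since `a \ b` divides it on the left. This is the source of the first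
selector relations. -/
theorem mul_rightResidue_eq_rightResidue_mul (h : ResidueDividesLcm (monoidAtoms M)) {a b : M}
    (ha : a ∈ monoidAtoms M) (hb : b ∈ monoidAtoms M) :
    a * rightResidue a b = rightResidue a b * rightResidue (rightResidue a b) (rightLcm a b) := by
  rw [mul_rightResidue_of_leftDiv (h a ha b hb), rightResidue_spec]

/-- In `a w = w v`, where `w` represents `a \ b`, equality of lengths forces `v` to be a single
letter. -/
theorem HasFiniteHomogeneousPresentation.residueClosed
    (h : HasFiniteHomogeneousPresentation (monoidAtoms M))
    (hd : ResidueDividesLcm (monoidAtoms M)) : ResidueClosed (monoidAtoms M) := by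
  intro a ha b hb
  have h1 := mul_rightResidue_eq_rightResidue_mul hd ha hb
  obtain ⟨w, hw⟩ := evalWord_surjective h.2.1 (rightResidue a b)
  obtain ⟨v, hv⟩ := evalWord_surjective h.2.1 (rightResidue (rightResidue a b) (rightLcm a b))
  rw [← hv]
  nth_rewrite 1 [← hw] at h1
  nth_rewrite 1 [← hw] at h1
  have h2 := exists_length_eq_of_homogeneous h (w := FreeMonoid.of ⟨a, ha⟩ * w) (w' := w * v)
    (by rw [map_mul, map_mul, evalWord_of, h1, hv])
  rw [FreeMonoid.length_mul, FreeMonoid.length_mul, FreeMonoid.length_of] at h2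
  obtain ⟨c, rfl⟩ := FreeMonoid.length_eq_one.1 (show v.length = 1 by omega)
  rw [evalWord_of]
  exact c.2

end Residues

/-! ### The action of the group of fractions on the presented quandle -/

section Quandles

variable {M : Type u} [Monoid M]

/-- The action on a quandle `Q` of the words in letters that are sent to elements of `Q`. -/
def wordAct {X : Type u} {Q : Type v} [Quandle Q] (g : X → Q) : FreeMonoid X →* Equiv.Perm Q :=
  FreeMonoid.lift fun x => Rack.act' (g x)

theorem wordAct_of_mul {X : Type u} {Q : Type v} [Quandle Q] (g : X → Q) (x : X)
    (w : FreeMonoid X) (q : Q) :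
    wordAct g (FreeMonoid.of x * w) q = Shelf.act (g x) (wordAct g w q) := by
  rw [map_mul, wordAct, FreeMonoid.lift_eval_of]
  rfl

theorem wordAct_of {X : Type u} {Q : Type v} [Quandle Q] (g : X → Q) (x : X) :
    wordAct g (FreeMonoid.of x) = Rack.act' (g x) :=
  FreeMonoid.lift_eval_of _ _

theorem starWord_of_mul {X : Type u} (c : QuandleTerm X) (x : X) (w : FreeMonoid X) :
    starWord c (FreeMonoid.of x * w) = (starWord c w).star (.of x) := rfl

/-- The last letter of a word acts first, which is why the selector relations list the letters in
reverse order. -/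
theorem eval_starWord {X : Type u} {Q : Type v} [Quandle Q] (g : X → Q) (c : QuandleTerm X)
    (w : FreeMonoid X) : (starWord c w).eval g = wordAct g w (c.eval g) := by
  induction w using FreeMonoid.inductionOn' with
  | one => rw [map_one]; rfl
  | of_mul x w ih => rw [wordAct_of_mul, starWord_of_mul, QuandleTerm.eval, ih]; rfl

theorem PresentedQuandle.eval_of {X : Type u} (rels : QuandleTerm X → QuandleTerm X → Prop)
    (t : QuandleTerm X) :
    t.eval (PresentedQuandle.of rels) = PresentedQuandle.mk rels t := by
  induction t with
  | of x => rfl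
  | star s t ihs iht => rw [QuandleTerm.eval, ihs, iht]; rfl
  | invStar s t ihs iht => rw [QuandleTerm.eval, ihs, iht]; rfl

theorem PresentedQuandle.eval_eq_of_rel {X : Type u} {rels : QuandleTerm X → QuandleTerm X → Prop}
    {s t : QuandleTerm X} (h : rels s t) :
    s.eval (PresentedQuandle.of rels) = t.eval (PresentedQuandle.of rels) := by
  rw [eval_of, eval_of]
  exact Quotient.sound (QuandleTerm.Equiv.rel h)

/-! ### Automorphisms of quandles -/

/-- The permutations of a quandle that are automorphisms. -/
def quandleAut (Q : Type v) [Quandle Q] : Subgroup (Equiv.Perm Q) where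
  carrier := {σ | ∀ x y, σ (Shelf.act x y) = Shelf.act (σ x) (σ y)}
  one_mem' _ _ := rfl
  mul_mem' h h' x y := by rw [Equiv.Perm.mul_apply, h', h]; rfl
  inv_mem' {σ} h x y := by
    apply σ.injective
    rw [h]
    simp only [← Equiv.Perm.mul_apply, mul_inv_cancel, Equiv.Perm.one_apply]

theorem act'_mem_quandleAut {Q : Type v} [Quandle Q] (x : Q) : Rack.act' x ∈ quandleAut Q :=
  fun _ _ => Shelf.self_distrib

theorem wordAct_mem_quandleAut {X : Type u} {Q : Type v} [Quandle Q] (g : X → Q)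
    (w : FreeMonoid X) : wordAct g w ∈ quandleAut Q := by
  induction w using FreeMonoid.inductionOn' with
  | one => rw [map_one]; exact one_mem _
  | of_mul x w ih => rw [map_mul, wordAct_of]; exact mul_mem (act'_mem_quandleAut _) ih

theorem map_invAct_of_mem_quandleAut {Q : Type v} [Quandle Q] {σ : Equiv.Perm Q}
    (h : σ ∈ quandleAut Q) (x y : Q) : σ (Rack.invAct x y) = Rack.invAct (σ x) (σ y) := by
  rw [← Rack.left_cancel (σ x), ← h, Rack.right_inv, Rack.right_inv]

/-- An automorphism conjugates the right translations of a quandle. -/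
theorem act'_apply_of_mem_quandleAut {Q : Type v} [Quandle Q] {σ : Equiv.Perm Q}
    (h : σ ∈ quandleAut Q) (x : Q) : Rack.act' (σ x) = σ * Rack.act' x * σ⁻¹ := by
  ext y
  simp only [Equiv.Perm.mul_apply, Rack.act'_apply, h x]
  rw [← Equiv.Perm.mul_apply σ, mul_inv_cancel, Equiv.Perm.one_apply]

/-- Automorphisms of a presented quandle that agree on the generators are equal. -/
theorem PresentedQuandle.aut_ext {X : Type u} {rels : QuandleTerm X → QuandleTerm X → Prop}
    {σ τ : Equiv.Perm (PresentedQuandle rels)} (hσ : σ ∈ quandleAut _) (hτ : τ ∈ quandleAut _)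
    (h : ∀ x, σ (of rels x) = τ (of rels x)) : σ = τ := by
  ext q
  obtain ⟨t, rfl⟩ : ∃ t, mk rels t = q := Quotient.exists_rep q
  rw [← eval_of]
  induction t with
  | of x => exact h x
  | star s t ihs iht => rw [QuandleTerm.eval, quandleStar, hσ, hτ, ihs, iht]
  | invStar s t ihs iht =>
    rw [QuandleTerm.eval, map_invAct_of_mem_quandleAut hσ, map_invAct_of_mem_quandleAut hτ,
      ihs, iht]

theorem DehnQuandle.act_val {G : Type v} [Group G] {S : Set G} (x y : DehnQuandle S) :
    (Shelf.act x y).1 = x.1 * y.1 * x.1⁻¹ := rfl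

theorem wordAct_atomToQuandle_val (w : FreeMonoid (monoidAtoms M)) (q : AtomQuandle M) :
    (wordAct (atomToQuandle M) w q).1 =
      toGroupOfFractions M (evalWord _ w) * q.1 * (toGroupOfFractions M (evalWord _ w))⁻¹ := by
  induction w using FreeMonoid.inductionOn' with
  | one => simp only [map_one, Equiv.Perm.one_apply, one_mul, inv_one, mul_one]
  | of_mul a w ih =>
    rw [wordAct_of_mul, DehnQuandle.act_val, ih, map_mul, map_mul, evalWord_of, mul_inv_rev]
    change toGroupOfFractions M a * _ * (toGroupOfFractions M a)⁻¹ = _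
    simp only [mul_assoc]

variable [IsRightGaussian M]

/-- The group of fractions acts on the quandle with the selector relations. -/
theorem exists_groupOfFractions_action
    {f : monoidAtoms M → monoidAtoms M → FreeMonoid (monoidAtoms M)}
    (hf : IsRightLcmSelector (monoidAtoms M) f) (β : monoidAtoms M → monoidAtoms M → monoidAtoms M) :
    ∃ Φ : GroupOfFractions M →* Equiv.Perm (PresentedQuandle (SelectorRelation β f)),
      (∀ w, Φ (toGroupOfFractions M (evalWord _ w)) = wordAct (PresentedQuandle.of _) w) ∧
        ∀ g, Φ g ∈ quandleAut _ := by
  obtain ⟨ψ, hψ⟩ := exists_lift_of_rightLcmSelector hf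
    (wordAct (PresentedQuandle.of (SelectorRelation β f))) (by
      intro a b hab
      -- For fixed `a` and `b`, the second relations, as `c` varies, say that these two
      -- automorphisms agree on all generators.
      refine PresentedQuandle.aut_ext (wordAct_mem_quandleAut _ _) (wordAct_mem_quandleAut _ _)
        fun c => ?_
      have h := PresentedQuandle.eval_eq_of_rel (SelectorRelation.second (β := β) (f := f) a b c hab)
      rwa [← starWord_of_mul, ← starWord_of_mul, eval_starWord, eval_starWord] at h)
  obtain ⟨Φ, hΦ, -⟩ := GroupOfFractions.exists_unique_lift ψ
  have h : ∀ w, Φ (toGroupOfFractions M (evalWord _ w)) = wordAct (PresentedQuandle.of _) w := by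
    intro w
    rw [← hψ, ← hΦ, MonoidHom.comp_apply]
  refine ⟨Φ, h, fun g => ?_⟩
  have hle : Subgroup.closure (toGroupOfFractions M '' monoidAtoms M) ≤ (quandleAut _).comap Φ := by
    rw [Subgroup.closure_le]
    rintro _ ⟨a, ha, rfl⟩
    change Φ (toGroupOfFractions M a) ∈ quandleAut _
    have := h (FreeMonoid.of ⟨a, ha⟩)
    rw [evalWord_of] at this
    rw [this]
    exact wordAct_mem_quandleAut _ _
  rw [GroupOfFractions.closure_atoms] at hle
  exact hle (Subgroup.mem_top g)

/-- Words act by conjugation by the elements they represent. So the first relations follow from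
`hβ`, and the second from the two words `a f(a,b)` and `b f(b,a)` representing the same l.c.m. -/
theorem atomToQuandle_respects
    {f : monoidAtoms M → monoidAtoms M → FreeMonoid (monoidAtoms M)}
    (hf : IsRightLcmSelector (monoidAtoms M) f) {β : monoidAtoms M → monoidAtoms M → monoidAtoms M}
    (hβ : ∀ a b : monoidAtoms M,
      (a : M) * rightResidue (a : M) b = rightResidue (a : M) b * β a b)
    (s t : QuandleTerm (monoidAtoms M)) (h : SelectorRelation β f s t) :
    s.eval (atomToQuandle M) = t.eval (atomToQuandle M) := by
  apply Subtype.ext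
  cases h with
  | first a b _ =>
    rw [eval_starWord, wordAct_atomToQuandle_val, hf.2]
    change _ * toGroupOfFractions M (β a b) * _ = toGroupOfFractions M a
    rw [← map_mul, ← hβ, map_mul, mul_inv_cancel_right]
  | second a b c _ =>
    rw [← starWord_of_mul, ← starWord_of_mul, eval_starWord, eval_starWord,
      wordAct_atomToQuandle_val, wordAct_atomToQuandle_val]
    have h : evalWord _ (FreeMonoid.of a * f a b) = evalWord _ (FreeMonoid.of b * f b a) := by
      rw [map_mul, map_mul, evalWord_of, evalWord_of, hf.2, hf.2, mul_rightResidue_comm]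
    rw [h]

/-- If `a` is an atom and `a * y = y * z`, then `z` is an atom, and `y` sends the generator `z` to
the generator `a`. -/
theorem exists_atom_of_mul_eq_mul
    {f : monoidAtoms M → monoidAtoms M → FreeMonoid (monoidAtoms M)}
    (hf : IsRightLcmSelector (monoidAtoms M) f) {β : monoidAtoms M → monoidAtoms M → monoidAtoms M}
    (hβ : ∀ a b : monoidAtoms M,
      (a : M) * rightResidue (a : M) b = rightResidue (a : M) b * β a b)
    {ψ : M →* Equiv.Perm (PresentedQuandle (SelectorRelation β f))}
    (hψ : ∀ w, ψ (evalWord _ w) = wordAct (PresentedQuandle.of _) w)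
    (a : monoidAtoms M) (y z : M) (h : a * y = y * z) :
    ∃ c : monoidAtoms M, (c : M) = z ∧
      ψ y (PresentedQuandle.of _ c) = PresentedQuandle.of _ a := by
  have hM : IsAtomicMonoid M := IsRightGaussian.atomic
  obtain ⟨n, hn⟩ := hM.exists_length_le y
  induction n using Nat.strong_induction_on generalizing a y z with
  | _ n ih =>
  obtain ⟨w, rfl⟩ := evalWord_surjective hM.2.1 y
  cases w using FreeMonoid.casesOn with
  | one =>
    rw [map_one, mul_one, one_mul] at h
    exact ⟨a, h, by rw [map_one, map_one]; rfl⟩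
  | of_mul b u =>
  -- If `y` starts with `a` itself, cancel that letter: the action of `a` fixes its own generator by
  -- idempotence.
  by_cases hab : a = b
  · subst hab
    have hlt : n - 1 < n := by
      have := hn _ rfl
      rw [FreeMonoid.length_mul, FreeMonoid.length_of] at this
      omega
    rw [map_mul, evalWord_of, mul_assoc] at h
    obtain ⟨c, hc, hcu⟩ := ih (n - 1) hlt a (evalWord _ u) z
      (IsRightGaussian.mul_left_cancel _ _ _ h) fun v hv => by
        have := hn (FreeMonoid.of a * v) (by rw [map_mul, map_mul, hv])
        rw [FreeMonoid.length_mul, FreeMonoid.length_of] at this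
        omega
    refine ⟨c, hc, ?_⟩
    rw [map_mul, map_mul, Equiv.Perm.mul_apply, hcu, hψ, wordAct_of]
    exact Quandle.fix (x := PresentedQuandle.of (SelectorRelation β f) a)
  -- Here `a y` is a common multiple of `a` and `b`, so `y = (a \ b) y'`, and cancelling `a \ b`
  -- leaves `β(a,b) y' = y' z`.
  · have hbu : (a : M) * evalWord _ (FreeMonoid.of b * u) = b * (evalWord _ u * z) := by
      rw [h, map_mul, evalWord_of, mul_assoc]
    obtain ⟨y', hy', -⟩ := exists_eq_rightResidue_mul hbu
    -- The selector word is nonempty for distinct atoms, which makes the bound for `y'` strictly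
    -- smaller.
    have hpos : 1 ≤ (f a b).length := by
      rw [Nat.one_le_iff_ne_zero, Ne, FreeMonoid.length_eq_zero, hf.1]
      exact hab
    have hlen : ∀ v, evalWord _ v = y' → (f a b).length + v.length ≤ n := fun v hv => by
      rw [← FreeMonoid.length_mul]
      exact hn _ (by rw [map_mul, hf.2, hv, hy'])
    obtain ⟨v, hv⟩ := evalWord_surjective hM.2.1 y'
    have hlt : n - 1 < n := by
      have := hlen v hv
      omega
    rw [hy', ← mul_assoc, hβ, mul_assoc, mul_assoc] at h
    obtain ⟨c, hc, hcu⟩ := ih (n - 1) hlt (β a b) y' z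
      (IsRightGaussian.mul_left_cancel _ _ _ h) fun v hv => by
        have := hlen v hv
        omega
    refine ⟨c, hc, ?_⟩
    -- The first relation says that `a \ b` sends the generator of `β(a,b)` to that of `a`.
    have h1 := PresentedQuandle.eval_eq_of_rel (SelectorRelation.first (β := β) (f := f) a b hab)
    rw [eval_starWord, ← hψ, hf.2] at h1
    rw [hy', map_mul, Equiv.Perm.mul_apply, hcu]
    exact h1

/-- Conjugate atoms of the group of fractions give generators of the presented quandle that
correspond under the action of the conjugating element. -/
theorem action_of_eq_of_conj
    {f : monoidAtoms M → monoidAtoms M → FreeMonoid (monoidAtoms M)}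
    (hf : IsRightLcmSelector (monoidAtoms M) f) {β : monoidAtoms M → monoidAtoms M → monoidAtoms M}
    (hβ : ∀ a b : monoidAtoms M,
      (a : M) * rightResidue (a : M) b = rightResidue (a : M) b * β a b)
    (hc : HasConjugatingMultiples (monoidAtoms M))
    {Φ : GroupOfFractions M →* Equiv.Perm (PresentedQuandle (SelectorRelation β f))}
    (hΦ : ∀ w, Φ (toGroupOfFractions M (evalWord _ w)) = wordAct (PresentedQuandle.of _) w)
    (a b : monoidAtoms M) (g : GroupOfFractions M)
    (h : g * toGroupOfFractions M a * g⁻¹ = toGroupOfFractions M b) :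
    Φ g (PresentedQuandle.of _ a) = PresentedQuandle.of _ b := by
  obtain ⟨x, y, rfl⟩ := GroupOfFractions.exists_eq_mul_inv g
  obtain ⟨y', z, hz⟩ := hc a a.2 y
  have hy : (a : M) * (y * y') = y * y' * z := by rw [← mul_assoc, hz]
  have hg : toGroupOfFractions M x * (toGroupOfFractions M y)⁻¹ =
      toGroupOfFractions M (x * y') * (toGroupOfFractions M (y * y'))⁻¹ := by
    rw [map_mul, map_mul]
    group
  -- In the group, `z` is the conjugate of `a` by `(y y')⁻¹`, hence that of `b` by `(x y')⁻¹`;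
  -- injectivity brings the equation back to the monoid.
  have hx : (b : M) * (x * y') = x * y' * z := by
    apply toGroupOfFractions_injective
    have h2 := congrArg (toGroupOfFractions M) hy
    rw [map_mul, map_mul _ (y * y') z] at h2
    rw [map_mul, map_mul _ (x * y') z, ← h, hg, eq_inv_mul_of_mul_eq h2.symm]
    group
  obtain ⟨c, hc1, hc2⟩ := exists_atom_of_mul_eq_mul hf hβ (ψ := Φ.comp (toGroupOfFractions M))
    hΦ a _ z hy
  obtain ⟨d, hd1, hd2⟩ := exists_atom_of_mul_eq_mul hf hβ (ψ := Φ.comp (toGroupOfFractions M))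
    hΦ b _ z hx
  obtain rfl : c = d := Subtype.ext (hc1.trans hd1.symm)
  rw [hg, map_mul, map_inv, Equiv.Perm.mul_apply, ← hd2, ← hc2]
  simp only [MonoidHom.comp_apply, ← Equiv.Perm.mul_apply, ← mul_assoc, inv_mul_cancel_right]

/-! ### The isomorphism with the Dehn quandle -/

theorem hasQuandlePresentation_atomQuandle
    {f : monoidAtoms M → monoidAtoms M → FreeMonoid (monoidAtoms M)}
    (hf : IsRightLcmSelector (monoidAtoms M) f) {β : monoidAtoms M → monoidAtoms M → monoidAtoms M}
    (hβ : ∀ a b : monoidAtoms M,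
      (a : M) * rightResidue (a : M) b = rightResidue (a : M) b * β a b)
    (hc : HasConjugatingMultiples (monoidAtoms M)) :
    HasQuandlePresentation (AtomQuandle M) (atomToQuandle M) (SelectorRelation β f) := by
  obtain ⟨Φ, hΦ, haut⟩ := exists_groupOfFractions_action hf β
  obtain ⟨e, ⟨he, heof⟩, -⟩ := PresentedQuandle.exists_unique_lift (atomToQuandle M)
    (atomToQuandle_respects hf hβ)
  have heact : ∀ x y, e (Shelf.act x y) = Shelf.act (e x) (e y) := fun x y => he y x
  have hΦatom : ∀ a : monoidAtoms M,
      Φ (toGroupOfFractions M a) = Rack.act' (PresentedQuandle.of _ a) := fun a => by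
    rw [← wordAct_of, ← hΦ, evalWord_of]
  -- Translations of the presented quandle are thus given by group elements, so the group orbits of
  -- the generators exhaust it.
  have hact : ∀ q, Rack.act' q = Φ (e q).1 := by
    intro q
    obtain ⟨t, rfl⟩ : ∃ t, PresentedQuandle.mk _ t = q := Quotient.exists_rep q
    rw [← PresentedQuandle.eval_of]
    induction t with
    | of a =>
      rw [QuandleTerm.eval, heof]
      exact (hΦatom a).symm
    | star s t ihs iht =>
      rw [QuandleTerm.eval, he, DehnQuandle.star_val, map_mul, map_mul, map_inv, ← ihs, ← iht]
      exact act'_apply_of_mem_quandleAut (act'_mem_quandleAut _) _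
    | invStar s t ihs iht =>
      -- The conjugation formula for `(s *⁻¹ t) * t = s` is solved for the translation by `s *⁻¹ t`.
      have h1 := act'_apply_of_mem_quandleAut (act'_mem_quandleAut
        (t.eval (PresentedQuandle.of (SelectorRelation β f))))
        (Rack.invAct (t.eval (PresentedQuandle.of _)) (s.eval (PresentedQuandle.of _)))
      have h2 := DehnQuandle.act_val (e (t.eval (PresentedQuandle.of _)))
        (e (Rack.invAct (t.eval (PresentedQuandle.of _)) (s.eval (PresentedQuandle.of _))))
      rw [← heact, Rack.right_inv] at h2
      rw [Rack.act'_apply, Rack.right_inv, ihs, iht, h2, map_mul, map_mul, map_inv] at h1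
      rw [QuandleTerm.eval]
      exact (mul_left_cancel (mul_right_cancel h1)).symm
  have hgen : ∀ q, ∃ g a, q = Φ g (PresentedQuandle.of _ a) := by
    intro q
    obtain ⟨t, rfl⟩ : ∃ t, PresentedQuandle.mk _ t = q := Quotient.exists_rep q
    rw [← PresentedQuandle.eval_of]
    induction t with
    | of a => exact ⟨1, a, by rw [map_one]; rfl⟩
    | star s t ihs _ =>
      obtain ⟨g, a, hg⟩ := ihs
      refine ⟨(e (t.eval (PresentedQuandle.of _))).1 * g, a, ?_⟩
      rw [map_mul, Equiv.Perm.mul_apply, ← hg, ← hact]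
      rfl
    | invStar s t ihs _ =>
      obtain ⟨g, a, hg⟩ := ihs
      refine ⟨(e (t.eval (PresentedQuandle.of _))).1⁻¹ * g, a, ?_⟩
      rw [map_mul, Equiv.Perm.mul_apply, ← hg, map_inv, ← hact]
      rfl
  have hequi : ∀ g q, (e (Φ g q)).1 = g * (e q).1 * g⁻¹ := by
    intro g
    have hg : g ∈ Subgroup.closure (toGroupOfFractions M '' monoidAtoms M) := by
      rw [GroupOfFractions.closure_atoms]; trivial
    induction hg using Subgroup.closure_induction with
    | mem g hg =>
      obtain ⟨a, ha, rfl⟩ := hg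
      intro q
      rw [hΦatom ⟨a, ha⟩, Rack.act'_apply, heact, DehnQuandle.act_val, heof]
      rfl
    | one => intro q; rw [map_one, Equiv.Perm.one_apply, one_mul, inv_one, mul_one]
    | mul g g' _ _ ih ih' =>
      intro q
      rw [map_mul, Equiv.Perm.mul_apply, ih, ih']
      group
    | inv g _ ih =>
      intro q
      have h1 := ih (Φ g⁻¹ q)
      rw [← Equiv.Perm.mul_apply, ← map_mul, mul_inv_cancel, map_one, Equiv.Perm.one_apply] at h1
      rw [h1]
      group
  refine ⟨Equiv.ofBijective e ⟨?_, ?_⟩, he, heof⟩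
  · intro q q' hq
    obtain ⟨g, a, rfl⟩ := hgen q
    obtain ⟨g', b, rfl⟩ := hgen q'
    have h1 := congrArg Subtype.val hq
    rw [hequi, hequi, heof, heof] at h1
    change g * toGroupOfFractions M a * g⁻¹ = g' * toGroupOfFractions M b * g'⁻¹ at h1
    -- Equality of the images means that `g'⁻¹ g` conjugates `a` to `b`.
    have h2 := action_of_eq_of_conj hf hβ hc hΦ a b (g'⁻¹ * g) (by
      rw [mul_inv_rev, inv_inv,
        show g'⁻¹ * g * toGroupOfFractions M a * (g⁻¹ * g') =
          g'⁻¹ * (g * toGroupOfFractions M a * g⁻¹) * g' by group, h1]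
      group)
    rw [← h2, ← Equiv.Perm.mul_apply, ← map_mul, mul_inv_cancel_left]
  · intro x
    obtain ⟨_, ⟨a, ha, rfl⟩, hx⟩ := Group.mem_conjugatesOfSet_iff.1 x.2
    obtain ⟨g, hg⟩ := isConj_iff.1 hx
    refine ⟨Φ g (PresentedQuandle.of _ ⟨a, ha⟩), Subtype.ext ?_⟩
    rw [hequi, heof]
    exact hg

theorem exists_hasQuandlePresentation (hd : ResidueDividesLcm (monoidAtoms M))
    (hr : ResidueClosed (monoidAtoms M)) (hc : HasConjugatingMultiples (monoidAtoms M))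
    (f : monoidAtoms M → monoidAtoms M → FreeMonoid (monoidAtoms M))
    (hf : IsRightLcmSelector (monoidAtoms M) f) :
    ∃ β : monoidAtoms M → monoidAtoms M → monoidAtoms M,
      (∀ a b, (β a b : M) = rightResidue (rightResidue (a : M) b) (rightLcm (a : M) b)) ∧
      HasQuandlePresentation (AtomQuandle M) (atomToQuandle M) (SelectorRelation β f) :=
  ⟨fun a b => ⟨_, hr a a.2 b b.2⟩, fun _ _ => rfl, hasQuandlePresentation_atomQuandle hf
    (fun a b => mul_rightResidue_eq_rightResidue_mul hd a.2 b.2) hc⟩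

end Quandles

theorem corollary2p13 :
    (∀ (M : Type u) [Monoid M] [IsRightGaussian M],
      (IsTypeR4 M ∨ IsTypeR5 M ∨ IsTypeR6.{u, v} M ∨ IsTypeR7.{u, v} M) →
      ∀ f : monoidAtoms M → monoidAtoms M → FreeMonoid (monoidAtoms M),
        IsRightLcmSelector (monoidAtoms M) f →
        ∃ β : monoidAtoms M → monoidAtoms M → monoidAtoms M,
          (∀ a b, (β a b : M) = rightResidue (rightResidue (a : M) b) (rightLcm (a : M) b)) ∧
          HasQuandlePresentation (AtomQuandle M) (atomToQuandle M) (SelectorRelation β f)) ∧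
    (∀ (N : Type u) [Monoid N] [IsGarside N],
      (IsTypeR8 N ∨ IsTypeR9 N) →
      ∀ f : monoidAtoms N → monoidAtoms N → FreeMonoid (monoidAtoms N),
        IsRightLcmSelector (monoidAtoms N) f →
        ∃ β : monoidAtoms N → monoidAtoms N → monoidAtoms N,
          (∀ a b, (β a b : N) = rightResidue (rightResidue (a : N) b) (rightLcm (a : N) b)) ∧
          HasQuandlePresentation (AtomQuandle N) (atomToQuandle N) (SelectorRelation β f)) := by
  refine ⟨fun M _ _ h f hf => ?_, fun N _ _ h f hf => ?_⟩
  · rcases h with ⟨hd, hr, hc⟩ | ⟨hd, hh, hc⟩ | ⟨hd, hr, hc⟩ | ⟨hd, hh, hc⟩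
    · exact exists_hasQuandlePresentation hd hr hc f hf
    · exact exists_hasQuandlePresentation hd (hh.residueClosed hd) hc f hf
    · exact exists_hasQuandlePresentation hd hr hc.hasConjugatingMultiples f hf
    · exact exists_hasQuandlePresentation hd (hh.residueClosed hd) hc.hasConjugatingMultiples f hf
  · have hc := IsGarside.hasConjugatingMultiples (monoidAtoms N)
    rcases h with ⟨hd, hr⟩ | ⟨hd, hh⟩
    · exact exists_hasQuandlePresentation hd hr hc f hf
    · exact exists_hasQuandlePresentation hd (hh.residueClosed hd) hc f hf
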